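/- For $x\in\mathbb{C}$ and $k\in\mathbb{N}$ write $\binom{x}{k}=\frac{x(x-1)\cdots(x-k+1)}{k!}$ (with $\binom{x}{0}=1$), and for $\vec m=(m_1,\dots,m_t)\in\mathbb{N}^t$ put $$\binom{x}{m_1,\dots,m_t,\;x-\sum_{j=1}^t m_j}=\binom{x}{m_1}\binom{x-m_1}{m_2}\cdots\binom{x-m_1-\cdots-m_{t-1}}{m_t}.$$ Let $t\ge 1$, let $\vec n,\vec p\in\mathbb{N}^t$ with $n_j\ge 0$ and $p_j\ge 1$ for all $j$, let $\gamma\in\mathbb{N}$ (with $\gamma\ge 0$) and $\alpha\in\mathbb{C}$. For $\vec m\in\mathbb{N}^t$ let $$Q(\vec m;\vec p;\gamma)=\frac{\gamma}{\vec m\cdot\vec p+\gamma}\binom{\vec m\cdot\vec p+\gamma}{m_1,\dots,m_t,\;\vec m\cdot(\vec p-\vec 1)+\gamma},$$ where $Q(\vec 0;\vec p;0)=1$. Then $$\sum_{\vec 0\le\vec i\le\vec n}(-1)^{i_1+\cdots+i_t}\binom{(\vec p-\vec 1)\cdot(\vec n-\vec i)+\alpha}{i_1,\dots,i_t,\;(\vec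 p-\vec 1)\cdot(\vec n-\vec i)+\alpha-\sum_{j=1}^t i_j}\,Q(\vec n-\vec i;\vec p;\gamma)=(-1)^{n_1+\cdots+n_t}\binom{\alpha-\gamma}{n_1,\dots,n_t,\;\alpha-\gamma-\sum_{j=1}^t n_j},$$ where $\vec 0\le\vec i\le\vec n$ is meant componentwise. -/

import Mathlib

/-- The generalized multinomial coefficient `(x; m₁, …, m_t, x - m₁ - ⋯ - m_t)` of a complex
number `x`, where `m₁, …, m_t` are natural numbers. The last lower entry is determined by the
others and does not appear as an argument. It is the product
`C(x, m₁) * C(x - m₁, m₂) * ⋯ * C(x - m₁ - ⋯ - m_{t-1}, m_t)`, with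
`C(x, k) = x (x - 1) ⋯ (x - k + 1) / k!`. -/
noncomputable def genMultinomial {t : ℕ} (x : ℂ) (m : Fin t → ℕ) : ℂ :=
  ∏ k : Fin t, Ring.choose (x - ∑ j ∈ Finset.Iio k, (m j : ℂ)) (m k)

/-- The vector Catalan number
`Q(n; p; γ) = γ / (n·p + γ) * (n·p + γ; n₁, …, n_t, n·(p - 1) + γ)`.
For `n = 0`, `γ = 0` the quotient reads `0 / 0`; the value there is `1`, as for `n = 0`, `γ ≥ 1`
(there is exactly one forest without trees). -/
noncomputable def vectorCatalan {t : ℕ} (n p : Fin t → ℕ) (γ : ℕ) : ℂ :=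
  if n = 0 ∧ γ = 0 then 1
  else (γ : ℂ) / ((∑ j, (n j : ℂ) * (p j : ℂ)) + γ) *
    genMultinomial ((∑ j, (n j : ℂ) * (p j : ℂ)) + γ) n

open Finset Polynomial

/-! After the substitution `m = n - i`, both sides are polynomials in `α` with the same difference
equation: the forward difference at `n` is minus the sum of the values at `n - e_j` over the `j`
with `n j > 0`. By induction on `∑ j, n j` their difference is 1-periodic, hence a constant
polynomial, and it remains to compare them at `α = γ`. There the right side is zero for `n ≠ 0`, and
the left side is a mixed finite difference of order `∑ j, n j` of a polynomial of smaller degree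
(`catalanConvolution_self`). -/

theorem descPochhammer_eval_add_one_sub {R : Type*} [CommRing R] (x : R) (k : ℕ) :
    (descPochhammer R k).eval (x + 1) - (descPochhammer R k).eval x =
      k * (descPochhammer R (k - 1)).eval x := by
  cases k with
  | zero => simp
  | succ k =>
    rw [descPochhammer_succ_eval k x, descPochhammer_succ_left]
    simp
    ring

theorem descPochhammer_eval_add {R : Type*} [CommRing R] (x : R) (k l : ℕ) :
    (descPochhammer R (k + l)).eval x =
      (descPochhammer R k).eval x * (descPochhammer R l).eval (x - k) := by
  rw [← descPochhammer_mul]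
  simp

theorem descPochhammer_eval_succ {R : Type*} [CommRing R] (x : R) (k : ℕ) :
    (descPochhammer R (k + 1)).eval x = x * (descPochhammer R k).eval (x - 1) := by
  rw [descPochhammer_succ_left]
  simp

theorem ringChoose_eq_descPochhammer_div (x : ℂ) (k : ℕ) :
    Ring.choose x k = (descPochhammer ℂ k).eval x / (k.factorial : ℂ) := by
  rw [Ring.choose_eq_smul, ← descPochhammer_map (Int.castRingHom ℂ), eval_map,
    ← algebraMap_int_eq, ← aeval_def, aeval_eq_smeval, smul_eq_mul, div_eq_inv_mul]

theorem genMultinomial_eq_descPochhammer_div {t : ℕ} (x : ℂ) (m : Fin t → ℕ) :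
    genMultinomial x m =
      (descPochhammer ℂ (∑ j, m j)).eval x / ∏ j, ((m j).factorial : ℂ) := by
  induction t with
  | zero => simp [genMultinomial]
  | succ t ih =>
    have h := ih (fun j => m j.castSucc)
    unfold genMultinomial at h ⊢
    rw [Fin.prod_univ_castSucc]
    simp only [Fin.sum_Iio_castSucc (fun j => (m j : ℂ)), Fin.Iio_last_eq_map, sum_map,
      Fin.coe_castSuccEmb]
    rw [h, Fin.prod_univ_castSucc, Fin.sum_univ_castSucc, descPochhammer_eval_add,
      ringChoose_eq_descPochhammer_div, div_mul_div_comm]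
    simp

/-- A product of `n` differences of translations, in expanded form, annihilates the powers of
exponent smaller than the order. -/
theorem alternating_sum_pow_eq_zero {ι : Type*} [Fintype ι] [DecidableEq ι] (n : ι → ℕ)
    (p : ι → ℂ) (k : ℕ) (hk : k < ∑ j, n j) :
    ∑ m ∈ Iic n, (∏ j, (-1 : ℂ) ^ (n j - m j) * ((n j).choose (m j) : ℂ)) *
      (∑ j, p j * m j) ^ k = 0 := by
  have hexp (s : Finset ι) (c : ι → ℂ) :
      ∏ j ∈ s, PowerSeries.rescale (c j) (PowerSeries.exp ℂ) =
        PowerSeries.rescale (∑ j ∈ s, c j) (PowerSeries.exp ℂ) := by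
    induction s using Finset.induction_on with
    | empty => simp
    | insert a s ha ih =>
      rw [prod_insert ha, sum_insert ha, ih, PowerSeries.exp_mul_exp_eq_exp_add]
  -- The sum to be killed is `k!` times the coefficient of `X ^ k` in this product, and each `exp (p
  -- j X) - 1` has zero constant term.
  have hdvd : (PowerSeries.X : PowerSeries ℂ) ^ (∑ j, n j) ∣
      ∏ j, (PowerSeries.rescale (p j) (PowerSeries.exp ℂ) - 1) ^ n j := by
    rw [← prod_pow_eq_pow_sum]
    refine prod_dvd_prod_of_dvd _ _ fun j _ => pow_dvd_pow_of_dvd ?_ _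
    rw [PowerSeries.X_dvd_iff]
    rw [← PowerSeries.coeff_zero_eq_constantCoeff_apply]
    simp [-PowerSeries.coeff_zero_eq_constantCoeff]
  have hpow (a : ℂ) (l : ℕ) : PowerSeries.rescale a (PowerSeries.exp ℂ) ^ l =
      PowerSeries.rescale (a * l) (PowerSeries.exp ℂ) := by
    rw [← map_pow, PowerSeries.exp_pow_eq_rescale_exp, PowerSeries.rescale_rescale, mul_comm]
  have hprod : ∏ j, (PowerSeries.rescale (p j) (PowerSeries.exp ℂ) - 1) ^ n j =
      ∑ m ∈ Iic n, PowerSeries.C (∏ j, (-1 : ℂ) ^ (n j - m j) * ((n j).choose (m j) : ℂ)) *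
        PowerSeries.rescale (∑ j, p j * m j) (PowerSeries.exp ℂ) := by
    have hIic : Iic n = Fintype.piFinset fun j => range (n j + 1) := by
      ext m
      simp [Pi.le_def]
    simp_rw [sub_eq_add_neg, add_pow, hIic, prod_univ_sum]
    refine sum_congr rfl fun m _ => ?_
    rw [← hexp, map_prod, ← prod_mul_distrib]
    refine prod_congr rfl fun j _ => ?_
    rw [hpow]
    simp
    ring
  have h := PowerSeries.X_pow_dvd_iff.mp hdvd k hk
  rw [hprod, map_sum] at h
  simp only [PowerSeries.coeff_C_mul, PowerSeries.coeff_rescale, PowerSeries.coeff_exp] at h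
  simp only [← mul_assoc, ← sum_mul] at h
  refine (mul_eq_zero.mp h).resolve_right ?_
  simp [Nat.factorial_ne_zero]

theorem alternating_sum_eval_eq_zero {ι : Type*} [Fintype ι] [DecidableEq ι] (n : ι → ℕ)
    (p : ι → ℂ) (P : ℂ[X]) (hP : P.natDegree < ∑ j, n j) :
    ∑ m ∈ Iic n, (∏ j, (-1 : ℂ) ^ (n j - m j) * ((n j).choose (m j) : ℂ)) *
      P.eval (∑ j, p j * m j) = 0 := by
  simp_rw [eval_eq_sum_range, mul_sum]
  rw [sum_comm]
  refine sum_eq_zero fun k hk => ?_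
  rw [mem_range] at hk
  simp_rw [mul_left_comm _ (P.coeff k), ← mul_sum]
  rw [alternating_sum_pow_eq_zero n p k (by omega), mul_zero]

/-- The multinomial coefficient of `x` with sign `(-1) ^ ∑ j, d j`. -/
noncomputable def signedMultinomial {t : ℕ} (d : Fin t → ℕ) (x : ℂ) : ℂ :=
  (-1) ^ (∑ j, d j) * ((descPochhammer ℂ (∑ j, d j)).eval x / ∏ j, ((d j).factorial : ℂ))

theorem sum_sub_single {t : ℕ} (d : Fin t → ℕ) (j : Fin t) (hj : 0 < d j) :
    ∑ k, (d - Pi.single j 1 : Fin t → ℕ) k + 1 = ∑ k, d k := by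
  rw [← add_sum_erase _ _ (mem_univ j), ← add_sum_erase _ d (mem_univ j)]
  have : ∑ k ∈ univ.erase j, (d - Pi.single j 1 : Fin t → ℕ) k = ∑ k ∈ univ.erase j, d k :=
    sum_congr rfl fun k hk => by simp [(mem_erase.mp hk).1]
  rw [this]
  simp
  omega

theorem prod_factorial_sub_single {t : ℕ} (d : Fin t → ℕ) (j : Fin t) (hj : 0 < d j) :
    (d j : ℂ) * ∏ k, (((d - Pi.single j 1 : Fin t → ℕ) k).factorial : ℂ) = ∏ k, ((d k).factorial : ℂ) := by
  rw [← mul_prod_erase _ _ (mem_univ j),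
    ← mul_prod_erase _ (fun k => ((d k).factorial : ℂ)) (mem_univ j), ← mul_assoc]
  congr 1
  · simp only [Pi.sub_apply, Pi.single_eq_same]
    exact_mod_cast Nat.mul_factorial_pred hj.ne'
  · exact prod_congr rfl fun k hk => by simp [(mem_erase.mp hk).1]

/-- Differencing the falling factorial brings out the factor `∑ j, d j`; its summand `d j` turns `(d
j)!` into `(d j - 1)!`. -/
theorem signedMultinomial_add_one_sub {t : ℕ} (d : Fin t → ℕ) (x : ℂ) :
    signedMultinomial d (x + 1) - signedMultinomial d x =
      -∑ j, if 0 < d j then signedMultinomial (d - Pi.single j 1) x else 0 := by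
  have hterm (j : Fin t) : (if 0 < d j then signedMultinomial (d - Pi.single j 1) x else 0) =
      -((d j : ℂ) * ((-1) ^ (∑ j, d j) * ((descPochhammer ℂ (∑ j, d j - 1)).eval x /
        ∏ j, ((d j).factorial : ℂ)))) := by
    split_ifs with hj
    · have hs := sum_sub_single d j hj
      have hs' : ∑ k, (d - Pi.single j 1 : Fin t → ℕ) k = ∑ k, d k - 1 := by omega
      have h0 : (d j : ℂ) ≠ 0 := by exact_mod_cast hj.ne'
      rw [← prod_factorial_sub_single d j hj, ← hs, signedMultinomial, pow_succ,
        Nat.add_sub_cancel, mul_comm (d j : ℂ) (∏ k, _), ← div_div]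
      field_simp
    · simp [Nat.eq_zero_of_not_pos hj]
  simp_rw [hterm, sum_neg_distrib, ← sum_mul, ← Nat.cast_sum, signedMultinomial, neg_neg]
  rw [← mul_sub, ← sub_div, descPochhammer_eval_add_one_sub]
  ring

/-- The Catalan convolution as a sum over the argument of the Catalan number. -/
noncomputable def catalanConvolution {t : ℕ} (q : (Fin t → ℕ) → ℂ) (p : Fin t → ℂ)
    (n : Fin t → ℕ) (α : ℂ) : ℂ :=
  ∑ m ∈ Iic n, signedMultinomial (n - m) (∑ j, (p j - 1) * m j + α) * q m

theorem catalanConvolution_add_one_sub {t : ℕ} (q : (Fin t → ℕ) → ℂ) (p : Fin t → ℂ)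
    (n : Fin t → ℕ) (α : ℂ) :
    catalanConvolution q p n (α + 1) - catalanConvolution q p n α =
      -∑ j, if 0 < n j then catalanConvolution q p (n - Pi.single j 1) α else 0 := by
  unfold catalanConvolution
  simp_rw [← sum_sub_distrib, ← sub_mul, ← add_assoc, signedMultinomial_add_one_sub, neg_mul,
    sum_neg_distrib, sum_mul]
  rw [sum_comm]
  congr 1
  refine sum_congr rfl fun j _ => ?_
  have hsub : Iic (n - Pi.single j 1) ⊆ Iic n := Iic_subset_Iic.mpr tsub_le_self
  split_ifs with hj
  · rw [← sum_subset hsub]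
    · refine sum_congr rfl fun m hm => ?_
      have := mem_Iic.mp hm j
      simp only [Pi.sub_apply, Pi.single_eq_same] at this
      rw [if_pos (by simp only [Pi.sub_apply]; omega), tsub_right_comm]
    · intro m hm hm'
      rw [mem_Iic] at hm hm'
      rw [if_neg, zero_mul]
      intro hlt
      simp only [Pi.sub_apply] at hlt
      refine hm' fun k => ?_
      have := hm k
      rcases eq_or_ne k j with rfl | hk
      · simp only [Pi.sub_apply, Pi.single_eq_same]
        omega
      · simpa [hk] using this
  · refine sum_eq_zero fun m _ => ?_
    rw [if_neg (by simp only [Pi.sub_apply]; omega), zero_mul]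

/-- The Catalan number in the form that is polynomial in `p` and `γ` for each `m`. -/
noncomputable def polynomialCatalan {t : ℕ} (p : Fin t → ℂ) (γ : ℂ) (m : Fin t → ℕ) : ℂ :=
  if m = 0 then 1
  else γ * ((descPochhammer ℂ (∑ j, m j - 1)).eval (∑ j, p j * m j + γ - 1) /
    ∏ j, ((m j).factorial : ℂ))

/-- At `α = γ` the two falling factorials in each summand are adjacent and fuse into one of length
`∑ j, n j - 1`, whose length no longer depends on `m`. -/
theorem catalanConvolution_self {t : ℕ} (p : Fin t → ℂ) (γ : ℂ) (n : Fin t → ℕ)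
    (hn : 0 < ∑ j, n j) : catalanConvolution (polynomialCatalan p γ) p n γ = 0 := by
  have hdeg : ((descPochhammer ℂ (∑ j, n j - 1)).comp (X + C (γ - 1))).natDegree <
      ∑ j, n j := by
    rw [natDegree_comp, descPochhammer_natDegree, natDegree_X_add_C]
    omega
  have hzero := alternating_sum_eval_eq_zero n p _ hdeg
  suffices h : catalanConvolution (polynomialCatalan p γ) p n γ =
      γ / (∏ j, ((n j).factorial : ℂ)) *
      ∑ m ∈ Iic n, (∏ j, (-1 : ℂ) ^ (n j - m j) * ((n j).choose (m j) : ℂ)) *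
        ((descPochhammer ℂ (∑ j, n j - 1)).comp (X + C (γ - 1))).eval (∑ j, p j * m j) by
    rw [h, hzero, mul_zero]
  rw [catalanConvolution, mul_sum]
  refine sum_congr rfl fun m hm => ?_
  have hle : ∀ j, m j ≤ n j := mem_Iic.mp hm
  have hfac : ∏ j, ((n j).factorial : ℂ) = (∏ j, ((n j).choose (m j) : ℂ)) *
      (∏ j, ((m j).factorial : ℂ)) * ∏ j, (((n - m) j).factorial : ℂ) := by
    rw [← prod_mul_distrib, ← prod_mul_distrib]
    refine prod_congr rfl fun j _ => ?_
    exact_mod_cast (Nat.choose_mul_factorial_mul_factorial (hle j)).symm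
  have hchoose : ∏ j, ((n j).choose (m j) : ℂ) ≠ 0 :=
    prod_ne_zero_iff.mpr fun j _ => by exact_mod_cast (Nat.choose_pos (hle j)).ne'
  have hm0 : ∏ j, ((m j).factorial : ℂ) ≠ 0 :=
    prod_ne_zero_iff.mpr fun j _ => by exact_mod_cast (m j).factorial_ne_zero
  have hnm0 : ∏ j, (((n - m) j).factorial : ℂ) ≠ 0 :=
    prod_ne_zero_iff.mpr fun j _ => by exact_mod_cast ((n - m) j).factorial_ne_zero
  have hsum : ∑ j, n j = ∑ j, m j + ∑ j, (n - m) j := by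
    rw [← sum_add_distrib]
    refine sum_congr rfl fun j _ => ?_
    have := hle j
    simp only [Pi.sub_apply]
    omega
  have key : (descPochhammer ℂ (∑ j, (n - m) j)).eval (∑ j, (p j - 1) * m j + γ) *
      (polynomialCatalan p γ m * ∏ j, ((m j).factorial : ℂ)) =
      γ * (descPochhammer ℂ (∑ j, n j - 1)).eval (∑ j, p j * m j + γ - 1) := by
    unfold polynomialCatalan
    split_ifs with h
    · subst h
      -- For `m = 0` the prefactor `γ` is the leading factor of the falling factorial of `γ`.
      obtain ⟨k, hk⟩ := Nat.exists_eq_succ_of_ne_zero hn.ne'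
      simp [hk, descPochhammer_eval_succ]
    · have hpos : 0 < ∑ j, m j := by
        rw [Nat.pos_iff_ne_zero]
        intro h0
        exact h (funext fun j => (sum_eq_zero_iff.mp h0) j (mem_univ j))
      -- The second falling factorial starts exactly where the first one, of length `∑ j, m j - 1`,
      -- stops.
      have harg : ∑ j, (p j - 1) * (m j : ℂ) + γ =
          ∑ j, p j * m j + γ - 1 - ((∑ j, m j - 1 : ℕ) : ℂ) := by
        rw [Nat.cast_pred hpos, Nat.cast_sum]
        simp only [sub_mul, one_mul, sum_sub_distrib]
        ring
      rw [show ∑ j, n j - 1 = (∑ j, m j - 1) + ∑ j, (n - m) j by omega,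
        descPochhammer_eval_add, harg]
      field_simp
  rw [signedMultinomial, prod_mul_distrib, prod_pow_eq_pow_sum, hfac, eval_comp]
  simp only [eval_add, eval_X, eval_C, ← add_sub_assoc]
  simp only [Pi.sub_apply] at key hnm0 ⊢
  field_simp
  linear_combination key

theorem exists_polynomial_catalanConvolution_sub {t : ℕ} (q : (Fin t → ℕ) → ℂ) (p : Fin t → ℂ)
    (γ : ℂ) (n : Fin t → ℕ) :
    ∃ P : ℂ[X], ∀ α, P.eval α =
      catalanConvolution q p n α - signedMultinomial n (α - γ) := by
  have hs (d : Fin t → ℕ) (c : ℂ) : ∃ P : ℂ[X], ∀ α, P.eval α = signedMultinomial d (c + α) :=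
    ⟨C ((-1) ^ (∑ j, d j)) * ((descPochhammer ℂ (∑ j, d j)).comp (C c + X) *
      C (∏ j, ((d j).factorial : ℂ))⁻¹), fun α => by
        simp [signedMultinomial, div_eq_mul_inv]⟩
  choose P hP using hs
  refine ⟨∑ m ∈ Iic n, P (n - m) (∑ j, (p j - 1) * m j) * C (q m) - P n (-γ), fun α => ?_⟩
  simp [eval_finsetSum, hP, catalanConvolution, neg_add_eq_sub]

theorem catalanConvolution_eq {t : ℕ} (p : Fin t → ℂ) (γ : ℂ) (n : Fin t → ℕ) (α : ℂ) :
    catalanConvolution (polynomialCatalan p γ) p n α = signedMultinomial n (α - γ) := by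
  induction hN : ∑ j, n j generalizing n α with
  | zero =>
    obtain rfl : n = 0 := funext fun j => (sum_eq_zero_iff.mp hN) j (mem_univ j)
    have : Iic (0 : Fin t → ℕ) = {0} := by
      ext m
      simp
    simp [catalanConvolution, this, signedMultinomial, polynomialCatalan]
  | succ N ih =>
    obtain ⟨P, hP⟩ :=
      exists_polynomial_catalanConvolution_sub (polynomialCatalan p γ) p γ n
    have hstep (β : ℂ) : P.eval (β + 1) = P.eval β := by
      have h1 := catalanConvolution_add_one_sub (polynomialCatalan p γ) p n β
      have h2 := signedMultinomial_add_one_sub n (β - γ)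
      have h3 : (∑ j, if 0 < n j then
            catalanConvolution (polynomialCatalan p γ) p (n - Pi.single j 1) β else 0) =
          ∑ j, if 0 < n j then signedMultinomial (n - Pi.single j 1) (β - γ) else 0 := by
        refine sum_congr rfl fun j _ => ?_
        split_ifs with hj
        · exact ih _ _ (by have := sum_sub_single n j hj; omega)
        · rfl
      rw [hP, hP, show β + 1 - γ = β - γ + 1 by ring]
      linear_combination h1 - h2 - h3
    have hbase : P.eval γ = 0 := by
      have hpos : 0 < ∑ j, n j := by omega
      rw [hP, catalanConvolution_self p γ n hpos, signedMultinomial, sub_self,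
        descPochhammer_ne_zero_eval_zero _ hpos.ne']
      simp
    have hroot (k : ℕ) : P.eval (γ + k) = 0 := by
      induction k with
      | zero => simpa using hbase
      | succ k ihk => rw [Nat.cast_succ, ← add_assoc, hstep, ihk]
    have hP0 : P = 0 := by
      refine eq_zero_of_infinite_isRoot P (Set.infinite_of_injective_forall_mem
        (f := fun k : ℕ => γ + k) ?_ hroot)
      intro a b hab
      simpa using hab
    exact sub_eq_zero.mp (by rw [← hP, hP0, eval_zero])

/-- For `m ≠ 0` and `γ > 0` the denominator cancels the leading factor of the falling factorial; for
`m ≠ 0` and `γ = 0` both sides vanish. -/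
theorem vectorCatalan_eq_polynomialCatalan {t : ℕ} (m p : Fin t → ℕ) (γ : ℕ) :
    vectorCatalan m p γ = polynomialCatalan (fun j => (p j : ℂ)) γ m := by
  have hcomm : ∑ j, (p j : ℂ) * (m j : ℂ) = ∑ j, (m j : ℂ) * (p j : ℂ) :=
    sum_congr rfl fun j _ => mul_comm _ _
  rw [vectorCatalan, polynomialCatalan, hcomm]
  rcases Nat.eq_zero_or_pos γ with rfl | hγ
  · simp
  · have hγ' : (γ : ℂ) ≠ 0 := by exact_mod_cast hγ.ne'
    rw [if_neg (by omega)]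
    split_ifs with h
    · subst h
      simp [genMultinomial, hγ']
    · have hpos : ∑ j, m j ≠ 0 := fun h0 =>
        h (funext fun j => (sum_eq_zero_iff.mp h0) j (mem_univ j))
      obtain ⟨k, hk⟩ := Nat.exists_eq_succ_of_ne_zero hpos
      have hne : (∑ j, (m j : ℂ) * (p j : ℂ)) + γ ≠ 0 := by
        have : (∑ j, m j * p j) + γ ≠ 0 := by omega
        exact_mod_cast this
      rw [genMultinomial_eq_descPochhammer_div, hk, descPochhammer_eval_succ, Nat.succ_sub_one]
      field_simp

theorem signedMultinomial_eq {t : ℕ} (d : Fin t → ℕ) (x : ℂ) :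
    signedMultinomial d x = (-1) ^ (∑ j, d j) * genMultinomial x d := by
  rw [signedMultinomial, genMultinomial_eq_descPochhammer_div]

theorem theorem1p2 (t : ℕ) (ht : 1 ≤ t) (n p : Fin t → ℕ) (hp : ∀ j, 1 ≤ p j)
    (γ : ℕ) (α : ℂ) :
    ∑ i ∈ Finset.Iic n,
        (-1 : ℂ) ^ (∑ j, i j) *
          genMultinomial ((∑ j, ((p j : ℂ) - 1) * ((n j : ℂ) - (i j : ℂ))) + α) i *
          vectorCatalan (n - i) p γ
      = (-1 : ℂ) ^ (∑ j, n j) * genMultinomial (α - (γ : ℂ)) n := by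

  rw [← signedMultinomial_eq, ← catalanConvolution_eq (fun j => (p j : ℂ)), catalanConvolution]
  refine sum_nbij' (fun i => n - i) (fun m => n - m) ?_ ?_ ?_ ?_ ?_
  · exact fun i _ => mem_Iic.mpr tsub_le_self
  · exact fun m _ => mem_Iic.mpr tsub_le_self
  · exact fun i hi => tsub_tsub_cancel_of_le (mem_Iic.mp hi)
  · exact fun m hm => tsub_tsub_cancel_of_le (mem_Iic.mp hm)
  · intro i hi
    have hle : ∀ j, i j ≤ n j := mem_Iic.mp hi
    rw [tsub_tsub_cancel_of_le (mem_Iic.mp hi), signedMultinomial_eq,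
      vectorCatalan_eq_polynomialCatalan]
    simp [Nat.cast_sub (hle _)]
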